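/- For a parameter $a\in[0.3,0.6]$ let $P=P_a$ be the closed convex quadrilateral with the clockwise ordered vertices $A=(0,1)$, $B=(a,1)$, $C=(1,0.2)$, $D=(0,0)$, and let $\lambda=0.8$, $\mu=\lambda^{-1}$. Let $S$ be the union of the four closed rays $\overrightarrow{AB},\overrightarrow{BC},\overrightarrow{CD},\overrightarrow{DA}$ (each starting at its first named vertex and passing through the second). For $x\in\mathbb R^2\setminus(P\cup S)$ there is exactly one vertex $v$ of $P$ such that $P$ lies on the left of the ray from $x$ through $v$; put $T x=v+\lambda(v-x)$. Let $X=\mathbb R^2\setminus\bigl(P\cup\bigcup_{i\ge0}T^{-i}S\bigr)$ be the set of points at which all iterates of $T$ are defined. A periodic orbit of $T$ of period $n\ge1$ is a tuple $(w_1,\dots,w_n)$ of points, with $w_{n+1}:=w_1$, such that for each $i$ either $w_i\notin P\cup S$ and $Tw_i=w_{i+1}$, or $w_i\in S$ and $w_{i+1}$ is a one-sided value of $T$ at $w_i$, that is, the limit of $T$ at $w_i$ along the points of $\mathbb R^2\setminus(P\cup S)$ in one of the two open half-planes bounded by the line that carries a singular ray through $w_i$ (where such points accumulate at $w_i$). It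 is attracting if the set $\{w_1,\dots,w_n\}$ has an open neighbourhood $U$ such that every $p\in U\cap X$ is asymptotic to it: for some $j$, $|T^kp-w_{k+j}|\to0$ as $k\to\infty$ (indices of $w$ mod $n$). Let $l=\mu+(1-a)\mu^2$ and, for $\varepsilon>0$, $R_1=[-l+\varepsilon,0]\times[1,1+\varepsilon^2]$ and $R_2=[-l+\varepsilon,0]\times[1-\varepsilon^2,1]$. Then there is $\varepsilon_0>0$ such that for every $N$ there are a parameter $a\in[0.3,0.6]$ and an attracting periodic orbit of $T$ that consists of $n\ge N$ pairwise distinct points (so that its least period is $n$) and meets $R_1\cup R_2$ for every $0<\varepsilon<\varepsilon_0$. -/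

import Mathlib

open Set Filter Topology

noncomputable section

namespace OuterBilliards

/-- The plane. -/
abbrev Plane := ℝ × ℝ

/-- The two-dimensional cross product. -/
def cross (u w : Plane) : ℝ := u.1 * w.2 - u.2 * w.1

section Polygon

variable {m : ℕ} [NeZero m] (V : Fin m → Plane)

/-- The closed convex polygon with vertices `V 0, …, V (m - 1)`. -/
def polygon : Set Plane := convexHull ℝ (range V)

/-- The polygon lies (weakly) on the left of the ray from `x` through `v`. -/
def PolygonOnLeft (x v : Plane) : Prop := ∀ z ∈ polygon V, 0 ≤ cross (v - x) (z - x)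

/-- The closed ray from the vertex `V i` through the next vertex `V (i + 1)` (cyclically). -/
def singularRay (i : Fin m) : Set Plane :=
  {x | ∃ t : ℝ, 0 ≤ t ∧ x = V i + t • (V (i + 1) - V i)}

/-- The union of the singular rays. -/
def singularSet : Set Plane := ⋃ i, singularRay V i

open Classical in
/-- Outer billiards about the polygon with contraction factor `r`. If there is exactly one vertex
`v` such that the polygon lies on the left of the ray from `x` through `v`, then `x` is sent to the
point `y` of this ray beyond `v` with `|xv| : |vy| = 1 : r`, that is `y = v + r (v - x)`.
(The value at all other points is a dummy; it is never used.) -/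
def T (r : ℝ) (x : Plane) : Plane :=
  if h : ∃! v, v ∈ range V ∧ PolygonOnLeft V x v then h.choose + r • (h.choose - x) else x

/-- The points outside the polygon at which all iterates of the map are well-defined. -/
def regularSet (r : ℝ) : Set Plane :=
  {x | x ∉ polygon V ∧ ∀ k : ℕ, (T V r)^[k] x ∉ singularSet V}

/-- The open half-plane on the left of the line through `V i` and `V (i + 1)`. -/
def leftSide (i : Fin m) : Set Plane := {z | 0 < cross (V (i + 1) - V i) (z - V i)}

/-- The open half-plane on the right of the line through `V i` and `V (i + 1)`. -/
def rightSide (i : Fin m) : Set Plane := {z | cross (V (i + 1) - V i) (z - V i) < 0}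

/-- `y` is a natural choice for the image of the point `x` of the singular set: it is the limit of
the map at `x` from one side `H` of the line that carries a singular ray through `x` (where the
domain of the map accumulates at `x` from this side). -/
def IsOneSidedValue (r : ℝ) (x y : Plane) : Prop :=
  ∃ i : Fin m, x ∈ singularRay V i ∧ ∃ H : Set Plane, (H = leftSide V i ∨ H = rightSide V i) ∧
    (𝓝[H \ (polygon V ∪ singularSet V)] x).NeBot ∧
    Tendsto (T V r) (𝓝[H \ (polygon V ∪ singularSet V)] x) (𝓝 y)

/-- `y` is an admissible image of `x`: the image of `x` under the map if the map is well-defined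
at `x`, and one of the natural choices if `x` is on the singular set. -/
def IsStep (r : ℝ) (x y : Plane) : Prop :=
  (x ∉ polygon V ∪ singularSet V ∧ T V r x = y) ∨ (x ∈ singularSet V ∧ IsOneSidedValue V r x y)

/-- `(w 0, …, w (n - 1))` is a (possibly degenerate) periodic orbit; `w` is extended to an
`n`-periodic sequence. -/
structure IsPeriodicOrbit (r : ℝ) (n : ℕ) (w : ℕ → Plane) : Prop where
  pos : 0 < n
  periodic : Function.Periodic w n
  step : ∀ k, IsStep V r (w k) (w (k + 1))

/-- The forward orbit of `p` is asymptotic to the periodic orbit `w`. -/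
def IsAsymptoticTo (r : ℝ) (p : Plane) (w : ℕ → Plane) : Prop :=
  ∃ j : ℕ, Tendsto (fun k : ℕ => dist ((T V r)^[k] p) (w (k + j))) atTop (𝓝 0)

/-- The periodic orbit `w` is attracting: it has a neighbourhood such that the orbit of every
regular point of this neighbourhood is asymptotic to it. -/
def IsAttracting (r : ℝ) (w : ℕ → Plane) : Prop :=
  ∃ U : Set Plane, IsOpen U ∧ range w ⊆ U ∧ ∀ p ∈ U ∩ regularSet V r, IsAsymptoticTo V r p w

end Polygon

/-- The contraction factor `0.8`. -/
def lam : ℝ := 4 / 5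

/-- The inverse of the contraction factor. -/
def mu : ℝ := lam⁻¹

/-- The vertices `A, B, C, D` (in clockwise order) of the quadrilateral with parameter `a`. -/
def quad (a : ℝ) : Fin 4 → Plane := ![(0, 1), (a, 1), (1, 1 / 5), (0, 0)]

/-- The point `G` on the line `BC` beyond `C` with `|BC| : |CG| = 1 : mu`. -/
def pointG (a : ℝ) : Plane := quad a 2 + mu • (quad a 2 - quad a 1)

/-- The number `l` for which the point `E` is `(-l, 1)`. -/
def ell (a : ℝ) : ℝ := mu + (1 - a) * mu ^ 2

/-- The point `E = (-l, 1)`.  -/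
def pointE (a : ℝ) : Plane := (-ell a, 1)

/-- `E` is on the line `AB`. -/
theorem pointE_mem_AB (a : ℝ) (ha : a ≠ 0) : pointE a ∈ line[ℝ, quad a 0, quad a 1] := by
  have : pointE a = AffineMap.lineMap (quad a 0) (quad a 1) (-ell a / a) := by
    ext <;> simp [pointE, quad, AffineMap.lineMap_apply, ha]
  rw [this]
  exact AffineMap.lineMap_mem_affineSpan_pair _ _ _

/-- `E` is on the line `DG`. -/
theorem pointE_mem_DG (a : ℝ) : pointE a ∈ line[ℝ, quad a 3, pointG a] := by
  have : pointE a = AffineMap.lineMap (quad a 3) (pointG a) (-mu) := by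
    ext <;> simp [pointE, pointG, quad, AffineMap.lineMap_apply, mu, lam, ell] <;> ring
  rw [this]
  exact AffineMap.lineMap_mem_affineSpan_pair _ _ _

/-- The closed rectangle with vertices `(0, 1)`, `(0, 1 + ε²)`, `(-l + ε, 1)`,
`(-l + ε, 1 + ε²)`. -/
def R₁ (a ε : ℝ) : Set Plane := Icc (-ell a + ε) 0 ×ˢ Icc 1 (1 + ε ^ 2)

/-- The reflection of `R₁` in the line through `E` and `A`, which is the line `y = 1`. -/
def R₂ (a ε : ℝ) : Set Plane := Icc (-ell a + ε) 0 ×ˢ Icc (1 - ε ^ 2) 1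

end OuterBilliards

end

/-! The line AB, of height 1, carries a one-dimensional system: D then C maps it to itself with
factor `lam ^ 2`, while A and B reverse it. Points just below AB are reflected in B when they lie to
the right of C, points just above are reflected in A, and points to the left of A go through D and
C. The orbit sought lies on AB and its image under D; on the singular ray it takes the one-sided
values belonging to orbits slightly below AB on their left-hand visits.

Let z be the abscissa measured as in `pt`. From just below AB on the left, D, C, B leads to abscissa
`36/25 * r - 64/125 * z`. If this is negative, D, C, A completes a long return z ↦ `lam ^ 6 * z`; if
positive, A completes a short return, which is affine with slope `lam ^ 4` and lands near 36/25. The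
break is at z = `45/16 * r`. The fixed point 0 of the long branch is therefore virtual, but it tends
to the break as r → 0, so orbits make ever more long returns. For r = `lam ^ (6 * Q)` there are
exactly Q of them before a short one, which gives period 6Q + 4.

Attraction has two ingredients. Every regular point of an explicit neighbourhood enters `returnSet`
(`inBasin_left` and its companions). There its itinerary is that of the orbit (`iterate_T_eq_itin`),
so the distance to the orbit shrinks by `lam` at each step (`itin_sub_itin`). Distinctness is
`orbit_injOn`. -/

noncomputable section

namespace OuterBilliards

/-! ### Strict tangency to a polygon. -/

section Tangent

variable {m : ℕ} {V : Fin m → Plane}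

/-- The ray from `x` through `V i` has all the other vertices strictly on its left. -/
def StrictTangent (V : Fin m → Plane) (i : Fin m) (x : Plane) : Prop :=
  ∀ j, j ≠ i → 0 < cross (V i - x) (V j - x)

theorem cross_swap (u w : Plane) : cross w u = -cross u w := by
  simp only [cross]; ring

theorem cross_self (u : Plane) : cross u u = 0 := by
  simp only [cross]; ring

theorem cross_combo (u z₁ z₂ x : Plane) {s t : ℝ} (h : s + t = 1) :
    cross u (s • z₁ + t • z₂ - x) = s * cross u (z₁ - x) + t * cross u (z₂ - x) := by
  obtain rfl : t = 1 - s := by linarith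
  simp only [cross, Prod.fst_sub, Prod.snd_sub, Prod.fst_add, Prod.snd_add, Prod.smul_fst,
    Prod.smul_snd, smul_eq_mul]
  ring

theorem StrictTangent.polygonOnLeft {i : Fin m} {x : Plane} (h : StrictTangent V i x) :
    PolygonOnLeft V x (V i) := by
  have hc : Convex ℝ {z : Plane | 0 ≤ cross (V i - x) (z - x)} := by
    intro z₁ h₁ z₂ h₂ s t hs ht hst
    simp only [mem_ofPred_eq] at *
    rw [cross_combo _ _ _ _ hst]
    positivity
  refine fun z hz => convexHull_min ?_ hc hz
  rintro _ ⟨j, rfl⟩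
  by_cases hj : j = i
  · subst hj; exact (cross_self _).ge
  · exact (h j hj).le

/-- If `V j` is strictly left of the ray through `V i`, then `V i` is strictly right of the ray
through `V j`; so no other vertex competes. -/
theorem StrictTangent.T_eq {i : Fin m} {x : Plane} (h : StrictTangent V i x) (r : ℝ) :
    T V r x = V i + r • (V i - x) := by
  have hu : ∀ v, v ∈ range V ∧ PolygonOnLeft V x v → v = V i := by
    rintro _ ⟨⟨j, rfl⟩, hj⟩
    by_contra hne
    have h₁ := h j (fun e => hne (e ▸ rfl))
    have h₂ := hj (V i) (subset_convexHull ℝ _ (mem_range_self i))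
    rw [cross_swap] at h₂
    linarith
  have hex : ∃! v, v ∈ range V ∧ PolygonOnLeft V x v :=
    ⟨V i, ⟨mem_range_self i, h.polygonOnLeft⟩, hu⟩
  have := hu _ hex.choose_spec.1
  rw [T, dif_pos hex, this]

theorem StrictTangent.notMem_polygon [Nontrivial (Fin m)] {i : Fin m} {x : Plane}
    (h : StrictTangent V i x) : x ∉ polygon V := by
  intro hx
  -- The open half-plane together with the single boundary point `V i` is convex and contains all
  -- vertices, but not x.
  have hc : Convex ℝ {z : Plane | z = V i ∨ 0 < cross (V i - x) (z - x)} := by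
    rw [convex_iff_forall_pos]
    intro z₁ h₁ z₂ h₂ s t hs ht hst
    simp only [mem_ofPred_eq] at *
    rw [cross_combo _ _ _ _ hst]
    rcases h₁ with rfl | h₁ <;> rcases h₂ with rfl | h₂
    · left; rw [← add_smul, hst, one_smul]
    · right; rw [cross_self]; positivity
    · right; rw [cross_self]; positivity
    · right; positivity
  have hsub : range V ⊆ {z : Plane | z = V i ∨ 0 < cross (V i - x) (z - x)} := by
    rintro _ ⟨j, rfl⟩
    by_cases hj : j = i
    · left; rw [hj]
    · exact Or.inr (h j hj)
  rcases convexHull_min hsub hc hx with hxi | hxi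
  · obtain ⟨j, hj⟩ := exists_ne i
    have := h j hj
    rw [← hxi] at this
    simp [cross] at this
  · simp [cross] at hxi

/-- On the ray from `V k`, the vertices `V k` and `V (k + 1)` are collinear with x, which excludes k
= i. For k ≠ i, clockwise orientation puts `V k` weakly on the right of the ray through `V i`. -/
theorem StrictTangent.notMem_singularSet [NeZero m] (hm : (1 : Fin m) ≠ 0)
    (hV : ∀ k j : Fin m, cross (V (k + 1) - V k) (V j - V k) ≤ 0) {i : Fin m} {x : Plane}
    (h : StrictTangent V i x) : x ∉ singularSet V := by
  intro hx
  obtain ⟨k, t, ht, rfl⟩ := mem_iUnion.1 hx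
  by_cases hk : k = i
  · subst hk
    have := h (k + 1) (by simpa using hm)
    simp only [cross, Prod.fst_sub, Prod.snd_sub, Prod.fst_add, Prod.snd_add, Prod.smul_fst,
      Prod.smul_snd, smul_eq_mul] at this
    nlinarith
  · have h₁ := h k hk
    have h₂ := mul_nonneg ht (neg_nonneg.2 (hV k i))
    simp only [cross, Prod.fst_sub, Prod.snd_sub, Prod.fst_add, Prod.snd_add, Prod.smul_fst,
      Prod.smul_snd, smul_eq_mul] at h₁ h₂
    nlinarith

end Tangent

/-! ### Tangency regions and one-sided values for the quadrilateral. -/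

section Quad

variable {a : ℝ}

theorem quad_convex (h₀ : 39 / 100 ≤ a) (h₁ : a ≤ 11 / 25) (k j : Fin 4) :
    cross (quad a (k + 1) - quad a k) (quad a j - quad a k) ≤ 0 := by
  fin_cases k <;> fin_cases j <;> simp [quad, cross] <;> linarith

theorem strictTangent_A (h₀ : 39 / 100 ≤ a) {p : Plane} (hx : 0 < p.1) (hy : 1 < p.2) :
    StrictTangent (quad a) 0 p := by
  intro j hj
  fin_cases j <;> simp [quad, cross] at hj ⊢ <;> nlinarith

theorem strictTangent_B (h₀ : 39 / 100 ≤ a) (h₁ : a ≤ 11 / 25) {p : Plane} (hx : 4 / 5 < p.1)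
    (hy : p.2 < 1) (hy' : 49 / 50 < p.2) : StrictTangent (quad a) 1 p := by
  intro j hj
  fin_cases j <;> simp [quad, cross] at hj ⊢ <;> nlinarith

theorem strictTangent_C (h₀ : 39 / 100 ≤ a) (h₁ : a ≤ 11 / 25) {p : Plane} (hx : 0 < p.1)
    (hx' : p.1 < 6 / 5) (hy : p.2 < -39 / 50) (hy' : -41 / 50 < p.2) :
    StrictTangent (quad a) 2 p := by
  intro j hj
  fin_cases j <;> simp [quad, cross] at hj ⊢ <;> nlinarith

theorem strictTangent_D (h₀ : 39 / 100 ≤ a) {p : Plane} (hx : p.1 < 0) (hy : 0 < p.2) :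
    StrictTangent (quad a) 3 p := by
  intro j hj
  fin_cases j <;> simp [quad, cross] at hj ⊢ <;> nlinarith

theorem StrictTangent.notMem_polygon_union (h₀ : 39 / 100 ≤ a) (h₁ : a ≤ 11 / 25) {i : Fin 4}
    {x : Plane} (h : StrictTangent (quad a) i x) :
    x ∉ polygon (quad a) ∪ singularSet (quad a) := by
  rintro (hx | hx)
  · exact h.notMem_polygon hx
  · exact h.notMem_singularSet (by decide) (quad_convex h₀ h₁) hx

/-- The reflection with contraction in the vertex `i`. -/
def refl (a : ℝ) (i : Fin 4) (x : Plane) : Plane := quad a i + lam • (quad a i - x)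

theorem refl_A (x : Plane) : refl a 0 x = (-(4 / 5) * x.1, 9 / 5 - 4 / 5 * x.2) := by
  ext <;> simp [refl, quad, lam] <;> ring

theorem refl_B (x : Plane) :
    refl a 1 x = (9 / 5 * a - 4 / 5 * x.1, 9 / 5 - 4 / 5 * x.2) := by
  ext <;> simp [refl, quad, lam] <;> ring

theorem refl_C (x : Plane) : refl a 2 x = (9 / 5 - 4 / 5 * x.1, 9 / 25 - 4 / 5 * x.2) := by
  ext <;> simp [refl, quad, lam] <;> ring

theorem refl_D (x : Plane) : refl a 3 x = (-(4 / 5) * x.1, -(4 / 5) * x.2) := by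
  ext <;> simp [refl, quad, lam]

theorem continuous_refl (i : Fin 4) : Continuous (refl a i) := by
  unfold refl; fun_prop

theorem refl_sub_refl (i : Fin 4) (x y : Plane) :
    refl a i x - refl a i y = -lam • (x - y) := by
  simp only [refl]; module

theorem StrictTangent.T_eq_refl {i : Fin 4} {x : Plane} (h : StrictTangent (quad a) i x) :
    T (quad a) lam x = refl a i x := h.T_eq lam

theorem StrictTangent.isStep (h₀ : 39 / 100 ≤ a) (h₁ : a ≤ 11 / 25) {i : Fin 4} {x : Plane}
    (h : StrictTangent (quad a) i x) : IsStep (quad a) lam x (refl a i x) :=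
  Or.inl ⟨h.notMem_polygon_union h₀ h₁, h.T_eq_refl⟩

theorem mem_singularRay_AB (h₀ : 39 / 100 ≤ a) {x : ℝ} (hx : 0 ≤ x) :
    ((x, 1) : Plane) ∈ singularRay (quad a) 0 := by
  have ha : 0 < a := by linarith
  refine ⟨x / a, by positivity, ?_⟩
  ext <;> simp [quad, ha.ne']

theorem mem_singularSet_DA {y : ℝ} (hy : 0 ≤ y) :
    ((0, y) : Plane) ∈ singularSet (quad a) := by
  refine mem_iUnion.2 ⟨3, y, hy, ?_⟩
  ext <;> simp [quad]

theorem leftSide_AB (h₀ : 39 / 100 ≤ a) : leftSide (quad a) 0 = univ ×ˢ Ioi (1 : ℝ) := by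
  ext ⟨x, y⟩
  simp only [leftSide, mem_ofPred_eq, mem_prod, mem_univ, mem_Ioi, true_and]
  simp [quad, cross]
  constructor <;> intro h <;> nlinarith

theorem rightSide_AB (h₀ : 39 / 100 ≤ a) : rightSide (quad a) 0 = univ ×ˢ Iio (1 : ℝ) := by
  ext ⟨x, y⟩
  simp only [rightSide, mem_ofPred_eq, mem_prod, mem_univ, mem_Iio, true_and]
  simp [quad, cross]
  constructor <;> intro h <;> nlinarith

/-- Strictly tangent points avoid the polygon and the singular rays, so removing these sets does not
change the filter within H, along which the map agrees with a continuous reflection. -/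
theorem isStep_of_eventually (h₀ : 39 / 100 ≤ a) (h₁ : a ≤ 11 / 25) {x : ℝ} (hx : 0 ≤ x)
    {H : Set Plane} (hH : H = leftSide (quad a) 0 ∨ H = rightSide (quad a) 0) {i : Fin 4}
    (h : ∀ᶠ z in 𝓝[H] ((x, 1) : Plane), StrictTangent (quad a) i z) :
    IsStep (quad a) lam (x, 1) (refl a i (x, 1)) := by
  have hray := mem_singularRay_AB h₀ hx
  have hne : (𝓝[H] ((x, 1) : Plane)).NeBot := by
    rw [← mem_closure_iff_nhdsWithin_neBot]
    rcases hH with rfl | rfl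
    · rw [leftSide_AB h₀, closure_prod_eq, closure_Ioi]; simp
    · rw [rightSide_AB h₀, closure_prod_eq, closure_Iio]; simp
  have heq : 𝓝[H \ (polygon (quad a) ∪ singularSet (quad a))] ((x, 1) : Plane)
      = 𝓝[H] ((x, 1) : Plane) := by
    rw [sdiff_eq, nhdsWithin_inter']
    refine inf_eq_left.2 (le_principal_iff.2 ?_)
    filter_upwards [h] with z hz using hz.notMem_polygon_union h₀ h₁
  refine Or.inr ⟨mem_iUnion.2 ⟨0, hray⟩, 0, hray, H, hH, heq ▸ hne, ?_⟩
  rw [heq]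
  refine Tendsto.congr' ?_ ((continuous_refl i).continuousWithinAt)
  filter_upwards [h] with z hz using hz.T_eq_refl.symm

theorem isStep_A (h₀ : 39 / 100 ≤ a) (h₁ : a ≤ 11 / 25) {x : ℝ} (hx : 0 < x) :
    IsStep (quad a) lam (x, 1) (refl a 0 (x, 1)) := by
  refine isStep_of_eventually h₀ h₁ hx.le (Or.inl rfl) ?_
  have hx' : ∀ᶠ z : Plane in 𝓝 (x, 1), 0 < z.1 := continuous_fst.continuousAt.eventually_const_lt hx
  filter_upwards [self_mem_nhdsWithin, mem_nhdsWithin_of_mem_nhds hx'] with z hz hzx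
  rw [leftSide_AB h₀] at hz
  exact strictTangent_A h₀ hzx hz.2

theorem isStep_B (h₀ : 39 / 100 ≤ a) (h₁ : a ≤ 11 / 25) {x : ℝ} (hx : 4 / 5 < x) :
    IsStep (quad a) lam (x, 1) (refl a 1 (x, 1)) := by
  refine isStep_of_eventually h₀ h₁ (by linarith) (Or.inr rfl) ?_
  have hx' : ∀ᶠ z : Plane in 𝓝 (x, 1), 4 / 5 < z.1 :=
    continuous_fst.continuousAt.eventually_const_lt hx
  have hy' : ∀ᶠ z : Plane in 𝓝 (x, 1), 49 / 50 < z.2 :=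
    continuous_snd.continuousAt.eventually_const_lt (by norm_num)
  filter_upwards [self_mem_nhdsWithin, mem_nhdsWithin_of_mem_nhds hx',
    mem_nhdsWithin_of_mem_nhds hy'] with z hz hzx hzy
  rw [rightSide_AB h₀] at hz
  exact strictTangent_B h₀ h₁ hzx hz.2 hzy

end Quad

/-! ### The parameter and the basin of the return set. -/

/-- The parameter of the quadrilateral, in terms of the small number `r`. -/
def param (r : ℝ) : ℝ := 244 / 625 + 46116 / 78125 * r

theorem le_param {r : ℝ} (hr : 0 < r) : 39 / 100 ≤ param r := by
  unfold param; linarith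

theorem param_le {r : ℝ} (hr : r ≤ 7 / 100) : param r ≤ 11 / 25 := by
  unfold param; linarith

/-- The point at height `1 + δ` with the horizontal coordinate `z`, measured from the fixed point
of the six-step return map. -/
def pt (r z δ : ℝ) : Plane := (z - 36 / 25 - 2304 / 3125 * r, 1 + δ)

/-- The set of points slightly below the line `AB`, just left of `A`, to which the orbits of all
regular points return. -/
def returnSet (r : ℝ) : Set Plane :=
  {p | ∃ z δ : ℝ, p = pt r z δ ∧ 36 / 25 - 4 / 25 * r < z ∧ z < 36 / 25 + 2304 / 3125 * r ∧
    -1 / 50 < δ ∧ δ < 0}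

/-- The regular orbit of `p` enters the return set. -/
def InBasin (r : ℝ) (p : Plane) : Prop :=
  (∀ k : ℕ, (T (quad (param r)) lam)^[k] p ∉ singularSet (quad (param r))) →
    ∃ m : ℕ, (T (quad (param r)) lam)^[m] p ∈ returnSet r

section Basin

variable {r : ℝ}

theorem InBasin.of_mem {p : Plane} (h : p ∈ returnSet r) : InBasin r p := fun _ => ⟨0, h⟩

theorem InBasin.of_mem_singularSet {p : Plane} (h : p ∈ singularSet (quad (param r))) :
    InBasin r p := fun hp => absurd h (hp 0)

theorem InBasin.of_T {p q : Plane} (hq : InBasin r q) (h : T (quad (param r)) lam p = q) :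
    InBasin r p := by
  subst h
  intro hp
  obtain ⟨m, hm⟩ := hq (fun k => hp (k + 1))
  exact ⟨m + 1, hm⟩

theorem InBasin.of_A (hr : 0 < r) {x y : ℝ} (hx : 0 < x) (hy : 1 < y)
    (h : InBasin r (-(4 / 5) * x, 9 / 5 - 4 / 5 * y)) : InBasin r (x, y) :=
  h.of_T ((strictTangent_A (le_param hr) hx hy).T_eq_refl.trans (refl_A _))

theorem InBasin.of_B (hr : 0 < r) (hr' : r ≤ 7 / 100) {x y : ℝ} (hx : 4 / 5 < x) (hy : y < 1)
    (hy' : 49 / 50 < y) (h : InBasin r (9 / 5 * param r - 4 / 5 * x, 9 / 5 - 4 / 5 * y)) :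
    InBasin r (x, y) :=
  h.of_T ((strictTangent_B (le_param hr) (param_le hr') hx hy hy').T_eq_refl.trans (refl_B _))

theorem InBasin.of_C (hr : 0 < r) (hr' : r ≤ 7 / 100) {x y : ℝ} (hx : 0 < x) (hx' : x < 6 / 5)
    (hy : y < -39 / 50) (hy' : -41 / 50 < y)
    (h : InBasin r (9 / 5 - 4 / 5 * x, 9 / 25 - 4 / 5 * y)) : InBasin r (x, y) :=
  h.of_T ((strictTangent_C (le_param hr) (param_le hr') hx hx' hy hy').T_eq_refl.trans (refl_C _))

theorem InBasin.of_D (hr : 0 < r) {x y : ℝ} (hx : x < 0) (hy : 0 < y)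
    (h : InBasin r (-(4 / 5) * x, -(4 / 5) * y)) : InBasin r (x, y) :=
  h.of_T ((strictTangent_D (le_param hr) hx hy).T_eq_refl.trans (refl_D _))

theorem InBasin.of_D_C (hr : 0 < r) (hr' : r ≤ 7 / 100) {x y : ℝ} (hx : -3 / 2 < x) (hx' : x < 0)
    (hy : y < 51 / 50) (hy' : 49 / 50 < y)
    (h : InBasin r (9 / 5 + 16 / 25 * x, 9 / 25 + 16 / 25 * y)) : InBasin r (x, y) := by
  refine .of_D hr hx' (by linarith) (.of_C hr hr' (by linarith) (by linarith) (by linarith)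
    (by linarith) ?_)
  convert h using 2 <;> ring

theorem InBasin.of_D_C_A (hr : 0 < r) (hr' : r ≤ 7 / 100) {x δ : ℝ} (hx : -3 / 2 < x)
    (hx' : x < 0) (hδ : 0 < δ) (hδ' : δ < 1 / 50)
    (h : InBasin r (-36 / 25 - 64 / 125 * x, 1 - 64 / 125 * δ)) : InBasin r (x, 1 + δ) := by
  refine .of_D_C hr hr' hx hx' (by linarith) (by linarith)
    (.of_A hr (by linarith) (by linarith) ?_)
  convert h using 2 <;> ring

/-- The constants of `param` are tuned for this formula: the fixed point z = 0 of the long return is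
sent to abscissa `36/25 * r`, just on the wrong side of the ray DA. -/
theorem InBasin.of_D_C_B (hr : 0 < r) (hr' : r ≤ 7 / 100) {z δ : ℝ}
    (hz : -3 / 50 + 2304 / 3125 * r < z) (hz' : z < 36 / 25 + 2304 / 3125 * r) (hδ : -1 / 50 < δ)
    (hδ' : δ < 0) (h : InBasin r (36 / 25 * r - 64 / 125 * z, 1 - 64 / 125 * δ)) :
    InBasin r (pt r z δ) := by
  refine .of_D_C hr hr' (by linarith) (by linarith) (by linarith) (by linarith)
    (.of_B hr hr' (by linarith) (by linarith) (by linarith) ?_)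
  convert h using 2
  · unfold param; ring
  · ring

theorem InBasin.of_long_return (hr : 0 < r) (hr' : r ≤ 7 / 100) {z δ : ℝ}
    (hz : 45 / 16 * r < z) (hz' : z < 36 / 25 + 2304 / 3125 * r) (hδ : -1 / 50 < δ)
    (hδ' : δ < 0) (h : InBasin r (pt r (4096 / 15625 * z) (4096 / 15625 * δ))) :
    InBasin r (pt r z δ) := by
  refine .of_D_C_B hr hr' (by linarith) hz' hδ hδ' ?_
  rw [show 1 - 64 / 125 * δ = 1 + (-(64 / 125) * δ) by ring]
  refine .of_D_C_A hr hr' (by linarith) (by linarith) (by linarith) (by linarith) ?_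
  convert h using 1
  ext <;> simp only [pt] <;> ring

theorem InBasin.of_short_return (hr : 0 < r) (hr' : r ≤ 7 / 100) {z δ : ℝ}
    (hz : -3 / 50 + 2304 / 3125 * r < z) (hz' : z < 45 / 16 * r) (hδ : -1 / 50 < δ)
    (hδ' : δ < 0)
    (h : InBasin r (pt r (36 / 25 - 1296 / 3125 * r + 256 / 625 * z) (256 / 625 * δ))) :
    InBasin r (pt r z δ) := by
  refine .of_D_C_B hr hr' hz (by linarith) hδ hδ' (.of_A hr (by linarith) (by linarith) ?_)
  convert h using 1
  ext <;> simp only [pt] <;> ring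

theorem inBasin_discontinuity (hr : 0 < r) (hr' : r ≤ 7 / 100) {δ : ℝ} (hδ : -1 / 50 < δ)
    (hδ' : δ < 0) : InBasin r (pt r (45 / 16 * r) δ) := by
  refine .of_D_C_B hr hr' (by linarith) (by linarith) hδ hδ' (.of_mem_singularSet ?_)
  -- `45/16 * r` is exactly the z whose image after D, C, B falls on the ray DA, so such points are
  -- not regular.
  rw [show 36 / 25 * r - 64 / 125 * (45 / 16 * r) = 0 by ring]
  exact mem_singularSet_DA (by linarith)

/-- Long returns multiply z by `lam ^ 6`, so the first value not above the break still exceeds `lam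
^ 6` times the break. The short branch maps this window into the return set, and would send the
break itself to abscissa 0, the right end of that set. -/
theorem inBasin_of_pow_le (hr : 0 < r) (hr' : r ≤ 7 / 100) (N : ℕ) {z δ : ℝ}
    (hz : 4096 / 15625 * (45 / 16 * r) < z) (hz' : z < 36 / 25 + 2304 / 3125 * r)
    (hN : (4096 / 15625) ^ N * z ≤ 45 / 16 * r) (hδ : -1 / 50 < δ) (hδ' : δ < 0) :
    InBasin r (pt r z δ) := by
  induction N generalizing z δ with
  | zero =>
    rcases (show z ≤ 45 / 16 * r by simpa using hN).lt_or_eq with h | rfl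
    · exact .of_short_return hr hr' (by linarith) h hδ hδ'
        (.of_mem ⟨_, _, rfl, by linarith, by linarith, by linarith, by linarith⟩)
    · exact inBasin_discontinuity hr hr' hδ hδ'
  | succ N ih =>
    rcases lt_trichotomy z (45 / 16 * r) with h | rfl | h
    · exact .of_short_return hr hr' (by linarith) h hδ hδ'
        (.of_mem ⟨_, _, rfl, by linarith, by linarith, by linarith, by linarith⟩)
    · exact inBasin_discontinuity hr hr' hδ hδ'
    · refine .of_long_return hr hr' h hz' hδ hδ' (ih (by linarith) (by linarith) ?_ (by linarith)
        (by linarith))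
      rwa [← mul_assoc, ← pow_succ]

theorem inBasin_of_gt (hr : 0 < r) (hr' : r ≤ 7 / 100) {z δ : ℝ}
    (hz : 4096 / 15625 * (45 / 16 * r) < z) (hz' : z < 36 / 25 + 2304 / 3125 * r)
    (hδ : -1 / 50 < δ) (hδ' : δ < 0) : InBasin r (pt r z δ) := by
  obtain ⟨N, hN⟩ := exists_pow_lt_of_lt_one hr (show (4096 / 15625 : ℝ) < 1 by norm_num)
  refine inBasin_of_pow_le hr hr' N hz hz' ?_ hδ hδ'
  have : (0 : ℝ) < (4096 / 15625) ^ N := by positivity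
  nlinarith

theorem inBasin_below (hr : 0 < r) (hr' : r ≤ 7 / 100) {x y : ℝ} (hx : -3 / 2 < x) (hx' : x < 0)
    (hy : 49 / 50 < y) (hy' : y < 1) : InBasin r (x, y) := by
  obtain ⟨z, rfl⟩ : ∃ z, x = z - 36 / 25 - 2304 / 3125 * r :=
    ⟨x + 36 / 25 + 2304 / 3125 * r, by ring⟩
  obtain ⟨δ, rfl⟩ : ∃ δ, y = 1 + δ := ⟨y - 1, by ring⟩
  change InBasin r (pt r z δ)
  by_cases h : 4096 / 15625 * (45 / 16 * r) < z
  · exact inBasin_of_gt hr hr' h (by linarith) (by linarith) (by linarith)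
  · exact .of_short_return hr hr' (by linarith) (by linarith) (by linarith) (by linarith)
      (inBasin_of_gt hr hr' (by linarith) (by linarith) (by linarith) (by linarith))

/-- Points of height 1 reach the ray AB after D and C, hence are not regular; points above AB are
carried below it by D, C, A. -/
theorem inBasin_left (hr : 0 < r) (hr' : r ≤ 7 / 100) {x y : ℝ} (hx : -3 / 2 < x) (hx' : x < 0)
    (hy : 49 / 50 < y) (hy' : y < 51 / 50) : InBasin r (x, y) := by
  rcases lt_trichotomy y 1 with h | rfl | h
  · exact inBasin_below hr hr' hx hx' hy h
  · refine .of_D_C hr hr' hx hx' hy' hy (.of_mem_singularSet (mem_iUnion.2 ⟨0, ?_⟩))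
    rw [show (9 / 25 + 16 / 25 * 1 : ℝ) = 1 by norm_num]
    exact mem_singularRay_AB (le_param hr) (by linarith)
  · obtain ⟨δ, rfl⟩ : ∃ δ, y = 1 + δ := ⟨y - 1, by ring⟩
    exact .of_D_C_A hr hr' hx hx' (by linarith) (by linarith)
      (inBasin_below hr hr' (by linarith) (by linarith) (by linarith) (by linarith))

theorem inBasin_above_AB (hr : 0 < r) (hr' : r ≤ 7 / 100) {x y : ℝ} (hx : 0 < x)
    (hx' : x < 1 / 5) (hy : 1 < y) (hy' : y < 51 / 50) : InBasin r (x, y) :=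
  .of_A hr hx hy (inBasin_left hr hr' (by linarith) (by linarith) (by linarith) (by linarith))

theorem inBasin_right (hr : 0 < r) (hr' : r ≤ 7 / 100) {x y : ℝ} (hx : 21 / 25 < x)
    (hx' : x < 9 / 5) (hy : 49 / 50 < y) (hy' : y < 51 / 50) : InBasin r (x, y) := by
  rcases lt_trichotomy y 1 with h | rfl | h
  · refine .of_B hr hr' (by linarith) h hy ?_
    rcases lt_trichotomy (9 / 5 * param r - 4 / 5 * x) 0 with h₀ | h₀ | h₀
    · exact inBasin_left hr hr' (by linarith [le_param hr]) h₀ (by linarith) (by linarith)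
    · rw [h₀]
      exact .of_mem_singularSet (mem_singularSet_DA (by linarith))
    · exact inBasin_above_AB hr hr' h₀ (by linarith [param_le hr']) (by linarith) (by linarith)
  · exact .of_mem_singularSet
      (mem_iUnion.2 ⟨0, mem_singularRay_AB (le_param hr) (by linarith)⟩)
  · exact .of_A hr (by linarith) h
      (inBasin_left hr hr' (by linarith) (by linarith) (by linarith) (by linarith))

theorem inBasin_bottom (hr : 0 < r) (hr' : r ≤ 7 / 100) {x y : ℝ} (hx : 0 < x)
    (hx' : x < 6 / 5) (hy : -41 / 50 < y) (hy' : y < -39 / 50) : InBasin r (x, y) :=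
  .of_C hr hr' hx hx' hy' hy
    (inBasin_right hr hr' (by linarith) (by linarith) (by linarith) (by linarith))

theorem mem_polygon_quad {a x y : ℝ} (ha : 0 < a) (hx : 0 ≤ x) (hxy : x ≤ a * y) (hy : y ≤ 1) :
    ((x, y) : Plane) ∈ polygon (quad a) := by
  have hxa : x / a ≤ y := by rw [div_le_iff₀ ha]; linarith
  have hx0 : 0 ≤ x / a := by positivity
  -- Barycentric coordinates in the triangle ABD.
  have heq : ((x, y) : Plane) = ∑ i, ![y - x / a, x / a, 0, 1 - y] i • quad a i := by
    ext <;> simp [Fin.sum_univ_four, quad, ha.ne']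
  rw [heq]
  exact (convex_convexHull ℝ (range (quad a))).sum_mem (t := Finset.univ)
    (w := ![y - x / a, x / a, 0, 1 - y]) (z := quad a)
    (by intro i _; fin_cases i <;> simp <;> linarith)
    (by simp [Fin.sum_univ_four])
    (fun i _ => subset_convexHull ℝ _ (mem_range_self i))

theorem inBasin_near_A (hr : 0 < r) (hr' : r ≤ 7 / 100) {x y : ℝ} (hx : 0 < x)
    (hx' : x < 1 / 5) (hy : 49 / 50 < y) (hy' : y < 51 / 50)
    (hP : ((x, y) : Plane) ∉ polygon (quad (param r))) : InBasin r (x, y) := by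
  have ha := le_param hr
  rcases le_or_gt y 1 with h | h
  · exact absurd (mem_polygon_quad (by linarith) hx.le (by nlinarith) h) hP
  · exact inBasin_above_AB hr hr' hx hx' h hy'

end Basin

/-! ### The periodic itinerary. -/

/-- The vertices in which the orbits starting in the return set are reflected: `Q` times
`D, C, B, D, C, A`, then `D, C, B, A`, and so on periodically. -/
def vert (Q k : ℕ) : Fin 4 :=
  if k % (6 * Q + 4) = 6 * Q + 3 ∨ k % (6 * Q + 4) % 6 = 5 then 0
  else if k % (6 * Q + 4) % 6 = 2 then 1
  else if k % (6 * Q + 4) % 3 = 1 then 2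
  else 3

/-- The sequence obtained from `p` by successive reflections in the vertices `vert Q k`. -/
def itin (a : ℝ) (Q : ℕ) (p : Plane) : ℕ → Plane
  | 0 => p
  | k + 1 => refl a (vert Q k) (itin a Q p k)

theorem vert_add_period (Q k : ℕ) : vert Q (k + (6 * Q + 4)) = vert Q k := by
  simp only [vert, Nat.add_mod_right]

theorem itin_add_period (a : ℝ) (Q : ℕ) (p : Plane) (k : ℕ) :
    itin a Q p (k + (6 * Q + 4)) = itin a Q (itin a Q p (6 * Q + 4)) k := by
  induction k with
  | zero => simp [itin]
  | succ k ih => rw [Nat.add_right_comm, itin, itin, ih, vert_add_period]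

/-- All reflections have linear part `-lam`, so the vertices cancel from differences. -/
theorem itin_sub_itin (a : ℝ) (Q : ℕ) (p q : Plane) (k : ℕ) :
    itin a Q p k - itin a Q q k = (-lam) ^ k • (p - q) := by
  induction k with
  | zero => simp [itin]
  | succ k ih => rw [itin, itin, refl_sub_refl, ih, smul_smul, pow_succ']

section Vert

variable {Q i : ℕ}

theorem vert_zero (h : i ≤ Q) : vert Q (6 * i) = 3 := by
  have : 6 * i % (6 * Q + 4) = 6 * i := Nat.mod_eq_of_lt (by omega)
  simp only [vert, this]
  rw [if_neg (by omega), if_neg (by omega), if_neg (by omega)]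

theorem vert_one (h : i ≤ Q) : vert Q (6 * i + 1) = 2 := by
  have : (6 * i + 1) % (6 * Q + 4) = 6 * i + 1 := Nat.mod_eq_of_lt (by omega)
  simp only [vert, this]
  rw [if_neg (by omega), if_neg (by omega), if_pos (by omega)]

theorem vert_two (h : i ≤ Q) : vert Q (6 * i + 2) = 1 := by
  have : (6 * i + 2) % (6 * Q + 4) = 6 * i + 2 := Nat.mod_eq_of_lt (by omega)
  simp only [vert, this]
  rw [if_neg (by omega), if_pos (by omega)]

theorem vert_three (h : i < Q) : vert Q (6 * i + 3) = 3 := by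
  have : (6 * i + 3) % (6 * Q + 4) = 6 * i + 3 := Nat.mod_eq_of_lt (by omega)
  simp only [vert, this]
  rw [if_neg (by omega), if_neg (by omega), if_neg (by omega)]

theorem vert_four (h : i < Q) : vert Q (6 * i + 4) = 2 := by
  have : (6 * i + 4) % (6 * Q + 4) = 6 * i + 4 := Nat.mod_eq_of_lt (by omega)
  simp only [vert, this]
  rw [if_neg (by omega), if_neg (by omega), if_pos (by omega)]

theorem vert_five (h : i < Q) : vert Q (6 * i + 5) = 0 := by
  have : (6 * i + 5) % (6 * Q + 4) = 6 * i + 5 := Nat.mod_eq_of_lt (by omega)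
  simp only [vert, this]
  rw [if_pos (by omega)]

theorem vert_last : vert Q (6 * Q + 3) = 0 := by
  have : (6 * Q + 3) % (6 * Q + 4) = 6 * Q + 3 := Nat.mod_eq_of_lt (by omega)
  simp [vert, this]

end Vert

section Itinerary

variable {r : ℝ} {Q : ℕ} (z δ : ℝ)

theorem itin_zero {i : ℕ} (h : i ≤ Q) :
    itin (param r) Q (pt r z δ) (6 * i) =
      pt r ((4096 / 15625) ^ i * z) ((4096 / 15625) ^ i * δ) := by
  induction i with
  | zero => simp [itin]
  | succ i ih =>
    rw [show 6 * (i + 1) = 6 * i + 5 + 1 by ring, itin, vert_five (by omega), refl_A, itin,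
      vert_four (by omega), refl_C, itin, vert_three (by omega), refl_D, itin,
      vert_two (by omega), refl_B, itin, vert_one (by omega), refl_C, itin,
      vert_zero (by omega), refl_D, ih (by omega)]
    ext <;> simp only [pt, param] <;> ring

theorem itin_one {i : ℕ} (h : i ≤ Q) :
    itin (param r) Q (pt r z δ) (6 * i + 1) =
      (-(4 / 5) * ((4096 / 15625) ^ i * z - 36 / 25 - 2304 / 3125 * r),
        -(4 / 5) * (1 + (4096 / 15625) ^ i * δ)) := by
  rw [itin, vert_zero h, refl_D, itin_zero z δ h]
  rfl

theorem itin_two {i : ℕ} (h : i ≤ Q) :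
    itin (param r) Q (pt r z δ) (6 * i + 2) =
      (9 / 5 + 16 / 25 * ((4096 / 15625) ^ i * z - 36 / 25 - 2304 / 3125 * r),
        1 + 16 / 25 * ((4096 / 15625) ^ i * δ)) := by
  rw [itin, vert_one h, refl_C, itin_one z δ h]
  ext <;> ring

theorem itin_three {i : ℕ} (h : i ≤ Q) :
    itin (param r) Q (pt r z δ) (6 * i + 3) =
      (36 / 25 * r - 64 / 125 * ((4096 / 15625) ^ i * z),
        1 - 64 / 125 * ((4096 / 15625) ^ i * δ)) := by
  rw [itin, vert_two h, refl_B, itin_two z δ h]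
  ext <;> simp only [param] <;> ring

theorem itin_four {i : ℕ} (h : i < Q) :
    itin (param r) Q (pt r z δ) (6 * i + 4) =
      (-(4 / 5) * (36 / 25 * r - 64 / 125 * ((4096 / 15625) ^ i * z)),
        -(4 / 5) * (1 - 64 / 125 * ((4096 / 15625) ^ i * δ))) := by
  rw [itin, vert_three h, refl_D, itin_three z δ h.le]

theorem itin_five {i : ℕ} (h : i < Q) :
    itin (param r) Q (pt r z δ) (6 * i + 5) =
      (9 / 5 + 16 / 25 * (36 / 25 * r - 64 / 125 * ((4096 / 15625) ^ i * z)),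
        1 - 1024 / 3125 * ((4096 / 15625) ^ i * δ)) := by
  rw [itin, vert_four h, refl_C, itin_four z δ h]
  ext <;> ring

theorem itin_period (hQ : (4096 / 15625 : ℝ) ^ Q = r) :
    itin (param r) Q (pt r z δ) (6 * Q + 4) =
      pt r (36 / 25 - 1296 / 3125 * r + 256 / 625 * (r * z)) (256 / 625 * (r * δ)) := by
  rw [itin, vert_last, refl_A, itin_three z δ le_rfl, hQ]
  ext <;> simp only [pt] <;> ring

variable {z δ}

/-- The possible positions of a point that is to be reflected in the vertex `v`; the number `e`
indicates on which side of the line `AB` the point is if it is close to this line. -/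
def Admissible (v : Fin 4) (e : ℝ) (p : Plane) : Prop :=
  (v = 3 ∧ p.1 < 0 ∧ -3 / 2 < p.1 ∧ 49 / 50 < p.2 ∧ p.2 < 51 / 50) ∨
  (v = 2 ∧ 0 < p.1 ∧ p.1 < 6 / 5 ∧ p.2 < -39 / 50 ∧ -41 / 50 < p.2) ∨
  (v = 1 ∧ 21 / 25 < p.1 ∧ p.1 < 9 / 5 ∧ 49 / 50 < p.2 ∧ p.2 = 1 + e) ∨
  (v = 0 ∧ (0 < p.1 ∧ p.1 < 1 / 5 ∨ 21 / 25 < p.1 ∧ p.1 < 9 / 5) ∧ p.2 = 1 - e)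

theorem exists_admissible (hr : 0 < r) (hr' : r ≤ 7 / 100) (hQ : (4096 / 15625 : ℝ) ^ Q = r)
    (hz : 36 / 25 - 4 / 25 * r < z) (hz' : z < 36 / 25 + 2304 / 3125 * r) (hδ : -1 / 50 < δ)
    (hδ' : δ ≤ 0) {k : ℕ} (hk : k < 6 * Q + 4) :
    ∃ c : ℝ, 0 < c ∧ Admissible (vert Q k) (c * δ) (itin (param r) Q (pt r z δ) k) := by
  obtain ⟨i, j, hj, rfl⟩ : ∃ i j, j < 6 ∧ k = 6 * i + j :=
    ⟨k / 6, k % 6, Nat.mod_lt _ (by norm_num), (Nat.div_add_mod _ _).symm⟩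
  have hi : i ≤ Q := by omega
  have he : (0 : ℝ) < (4096 / 15625) ^ i := by positivity
  have he₁ : (4096 / 15625 : ℝ) ^ i ≤ 1 := pow_le_one₀ (by norm_num) (by norm_num)
  have hez : (4096 / 15625 : ℝ) ^ i * z ≤ z := by nlinarith
  have hez₀ : 0 < (4096 / 15625 : ℝ) ^ i * z := by nlinarith
  have heδ : δ ≤ (4096 / 15625 : ℝ) ^ i * δ := by nlinarith
  have heδ₀ : (4096 / 15625 : ℝ) ^ i * δ ≤ 0 := by nlinarith
  -- Before the last block `lam ^ (6 * i)` is at least `r / lam ^ 6`, which keeps z beyond the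
  -- break; at i = Q it equals r and z has passed the break.
  have hlt : i < Q → 36 / 25 * r - 64 / 125 * ((4096 / 15625) ^ i * z) < 0 := by
    intro h
    have h₁ : (4096 / 15625 : ℝ) ^ Q ≤ (4096 / 15625) ^ (i + 1) :=
      pow_le_pow_of_le_one (by norm_num) (by norm_num) h
    rw [hQ, pow_succ] at h₁
    nlinarith
  interval_cases j
  · refine ⟨1, one_pos, Or.inl ⟨vert_zero hi, ?_⟩⟩
    rw [add_zero, itin_zero z δ hi]
    refine ⟨?_, ?_, ?_, ?_⟩ <;> simp only [pt] <;> linarith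
  · refine ⟨1, one_pos, Or.inr (Or.inl ⟨vert_one hi, ?_⟩)⟩
    rw [itin_one z δ hi]
    refine ⟨?_, ?_, ?_, ?_⟩ <;> dsimp only <;> linarith
  · refine ⟨16 / 25 * (4096 / 15625) ^ i, by positivity, Or.inr (Or.inr (Or.inl ⟨vert_two hi, ?_⟩))⟩
    rw [itin_two z δ hi]
    refine ⟨?_, ?_, ?_, ?_⟩ <;> dsimp only <;> linarith
  · rcases hi.lt_or_eq with h | rfl
    · refine ⟨1, one_pos, Or.inl ⟨vert_three h, ?_⟩⟩
      rw [itin_three z δ hi]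
      refine ⟨?_, ?_, ?_, ?_⟩ <;> dsimp only <;> linarith [hlt h]
    · refine ⟨64 / 125 * (4096 / 15625) ^ i, by positivity,
        Or.inr (Or.inr (Or.inr ⟨vert_last, ?_⟩))⟩
      rw [itin_three z δ hi]
      refine ⟨Or.inl ⟨?_, ?_⟩, ?_⟩ <;> dsimp only
      · rw [hQ]; nlinarith
      · linarith
      · ring
  · have h : i < Q := by omega
    refine ⟨1, one_pos, Or.inr (Or.inl ⟨vert_four h, ?_⟩)⟩
    rw [itin_four z δ h]
    refine ⟨?_, ?_, ?_, ?_⟩ <;> dsimp only <;> linarith [hlt h]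
  · have h : i < Q := by omega
    refine ⟨1024 / 3125 * (4096 / 15625) ^ i, by positivity,
      Or.inr (Or.inr (Or.inr ⟨vert_five h, ?_⟩))⟩
    rw [itin_five z δ h]
    refine ⟨Or.inr ⟨?_, ?_⟩, ?_⟩ <;> dsimp only <;> linarith [hlt h]

theorem Admissible.strictTangent (hr : 0 < r) (hr' : r ≤ 7 / 100) {v : Fin 4} {e : ℝ} {p : Plane}
    (h : Admissible v e p) (he : e < 0) : StrictTangent (quad (param r)) v p := by
  have ha := le_param hr
  have ha' := param_le hr'
  rcases h with ⟨rfl, h₁, -, h₂, -⟩ | ⟨rfl, h₁, h₂, h₃, h₄⟩ | ⟨rfl, h₁, -, h₂, h₃⟩ | ⟨rfl, h₁, h₂⟩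
  · exact strictTangent_D ha h₁ (by linarith)
  · exact strictTangent_C ha ha' h₁ h₂ h₃ h₄
  · exact strictTangent_B ha ha' (by linarith) (by linarith) h₂
  · exact strictTangent_A ha (by rcases h₁ with h₁ | h₁ <;> linarith) (by linarith)

theorem Admissible.isStep (hr : 0 < r) (hr' : r ≤ 7 / 100) {v : Fin 4} {p : Plane}
    (h : Admissible v 0 p) : IsStep (quad (param r)) lam p (refl (param r) v p) := by
  have ha := le_param hr
  have ha' := param_le hr'
  obtain ⟨x, y⟩ := p
  rcases h with ⟨rfl, h₁, -, h₂, -⟩ | ⟨rfl, h₁, h₂, h₃, h₄⟩ | ⟨rfl, h₁, -, h₂, h₃⟩ | ⟨rfl, h₁, h₂⟩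
  · exact (strictTangent_D ha h₁ (by linarith)).isStep ha ha'
  · exact (strictTangent_C ha ha' h₁ h₂ h₃ h₄).isStep ha ha'
  · obtain rfl : y = 1 := by simpa using h₃
    exact isStep_B ha ha' (lt_trans (by norm_num) h₁)
  · obtain rfl : y = 1 := by simpa using h₂
    exact isStep_A ha ha' (by rcases h₁ with h₁ | h₁ <;> linarith)

/-- Negative δ makes the admissible positions strictly tangent throughout one period. The period map
sends the return set into itself, so the argument restarts. -/
theorem iterate_T_eq_itin (hr : 0 < r) (hr' : r ≤ 7 / 100) (hQ : (4096 / 15625 : ℝ) ^ Q = r)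
    {p : Plane} (hp : p ∈ returnSet r) (k : ℕ) :
    (T (quad (param r)) lam)^[k] p = itin (param r) Q p k := by
  induction k using Nat.strong_induction_on generalizing p with
  | _ k ih =>
    obtain ⟨z, δ, rfl, hz, hz', hδ, hδ'⟩ := id hp
    rcases k with _ | k
    · rfl
    · have hstep : ∀ l ≤ k, l < 6 * Q + 4 →
          (T (quad (param r)) lam)^[l + 1] (pt r z δ) = itin (param r) Q (pt r z δ) (l + 1) := by
        intro l hl hl'
        obtain ⟨c, hc, h⟩ := exists_admissible hr hr' hQ hz hz' hδ hδ'.le hl'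
        rw [Function.iterate_succ_apply', ih l (by omega) hp, itin]
        exact (h.strictTangent hr hr' (by nlinarith)).T_eq_refl
      rcases lt_or_ge k (6 * Q + 4) with hk | hk
      · exact hstep k le_rfl hk
      · have hper := itin_period z δ hQ
        have hmem : itin (param r) Q (pt r z δ) (6 * Q + 4) ∈ returnSet r :=
          ⟨_, _, hper, by nlinarith, by nlinarith, by nlinarith, by nlinarith⟩
        obtain ⟨l, rfl⟩ := Nat.exists_eq_add_of_le' hk
        rw [Nat.add_right_comm, Function.iterate_add_apply, itin_add_period,
          hstep (6 * Q + 3) (by omega) (by omega), ih (l + 1) (by omega) hmem]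

end Itinerary

/-! ### The periodic orbit, from the fixed point of the period map. -/

/-- The initial point of the periodic orbit. -/
def orbitStart (r : ℝ) : ℝ := (36 / 25 - 1296 / 3125 * r) / (1 - 256 / 625 * r)

/-- The periodic orbit. -/
def orbit (r : ℝ) (Q : ℕ) : ℕ → Plane := itin (param r) Q (pt r (orbitStart r) 0)

section Orbit

variable {r : ℝ} {Q : ℕ}

theorem orbitStart_eq (hr' : r ≤ 7 / 100) :
    36 / 25 - 1296 / 3125 * r + 256 / 625 * (r * orbitStart r) = orbitStart r := by
  have h : orbitStart r * (1 - 256 / 625 * r) = 36 / 25 - 1296 / 3125 * r :=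
    div_mul_cancel₀ _ (by linarith)
  linarith

theorem lt_orbitStart (hr : 0 < r) (hr' : r ≤ 7 / 100) : 36 / 25 < orbitStart r := by
  rw [orbitStart, lt_div_iff₀ (by linarith)]; nlinarith

theorem orbitStart_lt (hr : 0 < r) (hr' : r ≤ 7 / 100) :
    orbitStart r < 36 / 25 + 1 / 2 * r := by
  rw [orbitStart, div_lt_iff₀ (by linarith)]; nlinarith

theorem orbit_periodic (hr' : r ≤ 7 / 100) (hQ : (4096 / 15625 : ℝ) ^ Q = r) :
    Function.Periodic (orbit r Q) (6 * Q + 4) := by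
  intro k
  rw [orbit, itin_add_period, itin_period _ _ hQ, orbitStart_eq hr', mul_zero, mul_zero]

theorem orbit_admissible (hr : 0 < r) (hr' : r ≤ 7 / 100) (hQ : (4096 / 15625 : ℝ) ^ Q = r)
    (k : ℕ) : Admissible (vert Q k) 0 (orbit r Q k) := by
  have hv : vert Q (k % (6 * Q + 4)) = vert Q k := by simp only [vert, Nat.mod_mod]
  rw [← (orbit_periodic hr' hQ).map_mod_nat, ← hv]
  have h₁ := lt_orbitStart hr hr'
  have h₂ := orbitStart_lt hr hr'
  obtain ⟨c, -, h⟩ := exists_admissible hr hr' hQ (z := orbitStart r) (δ := 0) (by linarith)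
    (by linarith) (by norm_num) le_rfl (Nat.mod_lt k (show 0 < 6 * Q + 4 by omega))
  rwa [mul_zero] at h

theorem orbit_isPeriodicOrbit (hr : 0 < r) (hr' : r ≤ 7 / 100)
    (hQ : (4096 / 15625 : ℝ) ^ Q = r) :
    IsPeriodicOrbit (quad (param r)) lam (6 * Q + 4) (orbit r Q) where
  pos := by omega
  periodic := orbit_periodic hr' hQ
  step k := (orbit_admissible hr hr' hQ k).isStep hr hr'

end Orbit

/-! ### Attraction of regular points. -/

section Attraction

variable {r : ℝ} {Q : ℕ}

theorem IsAsymptoticTo.of_iterate {m : ℕ} {V : Fin m → Plane} [NeZero m] {s : ℝ} {p : Plane}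
    {w : ℕ → Plane} {n : ℕ} (hw : Function.Periodic w n) (hn : 0 < n) {l : ℕ}
    (h : IsAsymptoticTo V s ((T V s)^[l] p) w) : IsAsymptoticTo V s p w := by
  obtain ⟨j, hj⟩ := h
  -- A delay of l steps is undone modulo n by adding l(n - 1), which avoids subtracting l from the
  -- phase.
  refine ⟨j + l * (n - 1), (tendsto_add_atTop_iff_nat l).1 (hj.congr fun k => ?_)⟩
  have : k + l + (j + l * (n - 1)) = k + j + l * n := by
    obtain ⟨n, rfl⟩ := Nat.exists_eq_succ_of_ne_zero hn.ne'
    simp only [Nat.succ_sub_one, Nat.succ_eq_add_one]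
    ring
  have hper : w (k + j + l * n) = w (k + j) := by simpa using hw.nat_mul l (k + j)
  rw [this, hper, Function.iterate_add_apply]

theorem isAsymptoticTo_orbit (hr : 0 < r) (hr' : r ≤ 7 / 100)
    (hQ : (4096 / 15625 : ℝ) ^ Q = r) {p : Plane} (hp : p ∈ returnSet r) :
    IsAsymptoticTo (quad (param r)) lam p (orbit r Q) := by
  refine ⟨0, ?_⟩
  have h : ∀ k : ℕ, dist ((T (quad (param r)) lam)^[k] p) (orbit r Q (k + 0)) =
      (4 / 5) ^ k * ‖p - pt r (orbitStart r) 0‖ := by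
    intro k
    rw [iterate_T_eq_itin hr hr' hQ hp, dist_eq_norm, add_zero, orbit, itin_sub_itin, norm_smul,
      norm_pow, norm_neg, lam]
    norm_num
  simp only [h]
  simpa using (tendsto_pow_atTop_nhds_zero_of_lt_one (show (0 : ℝ) ≤ 4 / 5 by norm_num)
    (by norm_num)).mul_const ‖p - pt r (orbitStart r) 0‖

theorem orbit_isAttracting (hr : 0 < r) (hr' : r ≤ 7 / 100)
    (hQ : (4096 / 15625 : ℝ) ^ Q = r) :
    IsAttracting (quad (param r)) lam (orbit r Q) := by
  -- One rectangle for each kind of position in `Admissible`, with two for vertex A, one of them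
  -- shared with B.
  refine ⟨Ioo (-3 / 2) 0 ×ˢ Ioo (49 / 50) (51 / 50) ∪ Ioo 0 (6 / 5) ×ˢ Ioo (-41 / 50) (-39 / 50) ∪
    (Ioo (21 / 25) (9 / 5) ×ˢ Ioo (49 / 50) (51 / 50) ∪
      Ioo 0 (1 / 5) ×ˢ Ioo (49 / 50) (51 / 50)), ?_, ?_, ?_⟩
  · exact ((isOpen_Ioo.prod isOpen_Ioo).union (isOpen_Ioo.prod isOpen_Ioo)).union
      ((isOpen_Ioo.prod isOpen_Ioo).union (isOpen_Ioo.prod isOpen_Ioo))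
  · rintro _ ⟨k, rfl⟩
    rcases orbit_admissible hr hr' hQ k with ⟨-, h₁, h₂, h₃, h₄⟩ | ⟨-, h₁, h₂, h₃, h₄⟩ |
      ⟨-, h₁, h₂, h₃, h₄⟩ | ⟨-, ⟨h₁, h₂⟩ | ⟨h₁, h₂⟩, h₄⟩
    · exact Or.inl (Or.inl ⟨⟨h₂, h₁⟩, h₃, h₄⟩)
    · exact Or.inl (Or.inr ⟨⟨h₁, h₂⟩, h₄, h₃⟩)
    · exact Or.inr (Or.inl ⟨⟨h₁, h₂⟩, h₃, by linarith⟩)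
    · exact Or.inr (Or.inr ⟨⟨h₁, h₂⟩, by linarith, by linarith⟩)
    · exact Or.inr (Or.inl ⟨⟨h₁, h₂⟩, by linarith, by linarith⟩)
  · rintro ⟨x, y⟩ ⟨hU, hP, hS⟩
    have hb : InBasin r (x, y) := by
      rcases hU with (⟨h₁, h₂⟩ | ⟨h₁, h₂⟩) | (⟨h₁, h₂⟩ | ⟨h₁, h₂⟩)
      · exact inBasin_left hr hr' h₁.1 h₁.2 h₂.1 h₂.2
      · exact inBasin_bottom hr hr' h₁.1 h₁.2 h₂.1 h₂.2
      · exact inBasin_right hr hr' h₁.1 h₁.2 h₂.1 h₂.2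
      · exact inBasin_near_A hr hr' h₁.1 h₁.2 h₂.1 h₂.2 hP
    obtain ⟨l, hl⟩ := hb hS
    exact (isAsymptoticTo_orbit hr hr' hQ hl).of_iterate (orbit_periodic hr' hQ) (by omega)

end Attraction

/-! ### Distinctness of the orbit points. -/

section Injectivity

variable {r : ℝ} {Q : ℕ}

/-- The first coordinate of every third point of the periodic orbit. -/
def coord (r : ℝ) (m : ℕ) : ℝ :=
  if m % 2 = 0 then (4096 / 15625) ^ (m / 2) * orbitStart r - 36 / 25 - 2304 / 3125 * r
  else 36 / 25 * r - 64 / 125 * ((4096 / 15625) ^ (m / 2) * orbitStart r)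

theorem coord_even (i : ℕ) :
    coord r (2 * i) = (4096 / 15625) ^ i * orbitStart r - 36 / 25 - 2304 / 3125 * r := by
  simp [coord]

theorem coord_odd (i : ℕ) :
    coord r (2 * i + 1) = 36 / 25 * r - 64 / 125 * ((4096 / 15625) ^ i * orbitStart r) := by
  have : (2 * i + 1) / 2 = i := by omega
  simp [coord, this, Nat.add_mod]

theorem orbit_three_mul {m : ℕ} (hm : m ≤ 2 * Q + 1) : orbit r Q (3 * m) = (coord r m, 1) := by
  obtain ⟨i, rfl | rfl⟩ := m.even_or_odd'
  · rw [show 3 * (2 * i) = 6 * i by ring, orbit, itin_zero _ _ (by omega), coord_even]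
    simp [pt]
  · rw [show 3 * (2 * i + 1) = 6 * i + 3 by ring, orbit, itin_three _ _ (by omega), coord_odd]
    simp

theorem orbit_three_mul_add_one {m : ℕ} (hm : m ≤ 2 * Q) :
    orbit r Q (3 * m + 1) = (-(4 / 5) * coord r m, -(4 / 5)) := by
  obtain ⟨i, rfl | rfl⟩ := m.even_or_odd'
  · rw [show 3 * (2 * i) + 1 = 6 * i + 1 by ring, orbit, itin_one _ _ (by omega), coord_even]
    simp
  · rw [show 3 * (2 * i + 1) + 1 = 6 * i + 4 by ring, orbit, itin_four _ _ (by omega), coord_odd]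
    simp

theorem orbit_three_mul_add_two {m : ℕ} (hm : m ≤ 2 * Q) :
    orbit r Q (3 * m + 2) = (9 / 5 + 16 / 25 * coord r m, 1) := by
  obtain ⟨i, rfl | rfl⟩ := m.even_or_odd'
  · rw [show 3 * (2 * i) + 2 = 6 * i + 2 by ring, orbit, itin_two _ _ (by omega), coord_even]
    simp
  · rw [show 3 * (2 * i + 1) + 2 = 6 * i + 5 by ring, orbit, itin_five _ _ (by omega), coord_odd]
    simp

theorem pow_mul_orbitStart_mem (hr : 0 < r) (hr' : r ≤ 7 / 100) (i : ℕ) :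
    (4096 / 15625) ^ i * orbitStart r ∈ Ioo 0 (59 / 40) := by
  have h₁ := lt_orbitStart hr hr'
  have h₂ := orbitStart_lt hr hr'
  have he : (0 : ℝ) < (4096 / 15625) ^ i := by positivity
  have he₁ : (4096 / 15625 : ℝ) ^ i ≤ 1 := pow_le_one₀ (by norm_num) (by norm_num)
  constructor <;> nlinarith

theorem coord_mem (hr : 0 < r) (hr' : r ≤ 7 / 100) (m : ℕ) :
    coord r m ∈ Ioo (-3 / 2) (1 / 5) := by
  obtain ⟨i, rfl | rfl⟩ := m.even_or_odd' <;> obtain ⟨h₁, h₂⟩ := pow_mul_orbitStart_mem hr hr' i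
  · rw [coord_even]; constructor <;> linarith
  · rw [coord_odd]; constructor <;> linarith

/-- For i ≥ 1 the even value is far to the left of all odd ones. For i = 0 it is negative of order
r, whereas the odd value is positive if j = Q and is still further left if j < Q. -/
theorem coord_even_ne_odd (hr : 0 < r) (hr' : r ≤ 7 / 100) (hQ : (4096 / 15625 : ℝ) ^ Q = r)
    (i : ℕ) {j : ℕ} (hj : j ≤ Q) : coord r (2 * i) ≠ coord r (2 * j + 1) := by
  rw [coord_even, coord_odd]
  have h₁ := lt_orbitStart hr hr'
  have h₂ := orbitStart_lt hr hr'
  rcases i with _ | i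
  · rcases hj.lt_or_eq with hj | rfl
    · have h : (4096 / 15625 : ℝ) ^ Q ≤ (4096 / 15625) ^ (j + 1) :=
        pow_le_pow_of_le_one (by norm_num) (by norm_num) hj
      rw [hQ, pow_succ] at h
      rw [pow_zero]
      nlinarith
    · rw [hQ, pow_zero]
      nlinarith
  · have h₃ := (pow_mul_orbitStart_mem hr hr' i).2
    have h₄ := (pow_mul_orbitStart_mem hr hr' j).2
    rw [pow_succ]
    intro h
    linarith

theorem coord_injOn (hr : 0 < r) (hr' : r ≤ 7 / 100) (hQ : (4096 / 15625 : ℝ) ^ Q = r) :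
    InjOn (coord r) (Iic (2 * Q + 1)) := by
  intro m hm l hl h
  rw [mem_Iic] at hm hl
  have h₀ : orbitStart r ≠ 0 := by linarith [lt_orbitStart hr hr']
  have hinj : Function.Injective fun i : ℕ => (4096 / 15625 : ℝ) ^ i :=
    pow_right_injective₀ (by norm_num) (by norm_num)
  obtain ⟨i, rfl | rfl⟩ := m.even_or_odd' <;> obtain ⟨j, rfl | rfl⟩ := l.even_or_odd'
  · rw [coord_even, coord_even] at h
    rw [hinj (mul_right_cancel₀ h₀ (by linarith :
      (4096 / 15625 : ℝ) ^ i * orbitStart r = (4096 / 15625) ^ j * orbitStart r))]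
  · exact absurd h (coord_even_ne_odd hr hr' hQ i (by omega))
  · exact absurd h.symm (coord_even_ne_odd hr hr' hQ j (by omega))
  · rw [coord_odd, coord_odd] at h
    rw [hinj (mul_right_cancel₀ h₀ (by linarith :
      (4096 / 15625 : ℝ) ^ i * orbitStart r = (4096 / 15625) ^ j * orbitStart r))]

theorem orbit_injOn (hr : 0 < r) (hr' : r ≤ 7 / 100) (hQ : (4096 / 15625 : ℝ) ^ Q = r) :
    InjOn (orbit r Q) (Iio (6 * Q + 4)) := by
  intro k hk l hl h
  rw [mem_Iio] at hk hl
  obtain ⟨m, i, hi, rfl⟩ : ∃ m i, i < 3 ∧ k = 3 * m + i :=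
    ⟨k / 3, k % 3, Nat.mod_lt _ (by norm_num), (Nat.div_add_mod _ _).symm⟩
  obtain ⟨m', j, hj, rfl⟩ : ∃ m i, i < 3 ∧ l = 3 * m + i :=
    ⟨l / 3, l % 3, Nat.mod_lt _ (by norm_num), (Nat.div_add_mod _ _).symm⟩
  obtain ⟨h₁, h₂⟩ := coord_mem hr hr' m
  obtain ⟨h₃, h₄⟩ := coord_mem hr hr' m'
  suffices coord r m = coord r m' ∧ i = j by
    rw [coord_injOn hr hr' hQ (by rw [mem_Iic]; omega) (by rw [mem_Iic]; omega) this.1, this.2]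
  interval_cases i <;> interval_cases j <;> (try rw [add_zero] at h) <;> (try rw [add_zero] at h)
  · rw [orbit_three_mul (by omega), orbit_three_mul (by omega), Prod.mk.injEq] at h
    exact ⟨h.1, rfl⟩
  · rw [orbit_three_mul (by omega), orbit_three_mul_add_one (by omega), Prod.mk.injEq] at h
    linarith [h.2]
  · rw [orbit_three_mul (by omega), orbit_three_mul_add_two (by omega), Prod.mk.injEq] at h
    linarith [h.1]
  · rw [orbit_three_mul_add_one (by omega), orbit_three_mul (by omega), Prod.mk.injEq] at h
    linarith [h.2]
  · rw [orbit_three_mul_add_one (by omega), orbit_three_mul_add_one (by omega),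
      Prod.mk.injEq] at h
    exact ⟨by linarith [h.1], rfl⟩
  · rw [orbit_three_mul_add_one (by omega), orbit_three_mul_add_two (by omega),
      Prod.mk.injEq] at h
    linarith [h.2]
  · rw [orbit_three_mul_add_two (by omega), orbit_three_mul (by omega), Prod.mk.injEq] at h
    linarith [h.1]
  · rw [orbit_three_mul_add_two (by omega), orbit_three_mul_add_one (by omega),
      Prod.mk.injEq] at h
    linarith [h.2]
  · rw [orbit_three_mul_add_two (by omega), orbit_three_mul_add_two (by omega),
      Prod.mk.injEq] at h
    exact ⟨by linarith [h.1], rfl⟩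

end Injectivity

/-- The starting point has height exactly 1 and abscissa between -r and 0, while `ell` exceeds 2;
hence one orbit serves all ε at once. -/
theorem orbit_zero_mem_R₁ {r : ℝ} {Q : ℕ} (hr : 0 < r) (hr' : r ≤ 7 / 100) {ε : ℝ}
    (hε : ε < 1 / 2) : orbit r Q 0 ∈ R₁ (param r) ε := by
  have h₁ := lt_orbitStart hr hr'
  have h₂ := orbitStart_lt hr hr'
  have h₃ := param_le hr'
  simp only [orbit, itin, pt, R₁, mem_prod, mem_Icc, ell, mu, lam]
  refine ⟨⟨?_, ?_⟩, ?_, ?_⟩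
  · norm_num
    linarith
  · linarith
  · norm_num
  · nlinarith

end OuterBilliards

end

theorem corollary3p7 :
    ∃ ε₀ : ℝ, 0 < ε₀ ∧
      ∀ N : ℕ, ∃ a ∈ Set.Icc (3 / 10 : ℝ) (6 / 10), ∃ n : ℕ, N ≤ n ∧ ∃ w : ℕ → ℝ × ℝ,
        OuterBilliards.IsPeriodicOrbit (OuterBilliards.quad a) OuterBilliards.lam n w ∧
        Set.InjOn w (Set.Iio n) ∧
        OuterBilliards.IsAttracting (OuterBilliards.quad a) OuterBilliards.lam w ∧
        ∀ ε : ℝ, 0 < ε → ε < ε₀ →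
          (Set.range w ∩ (OuterBilliards.R₁ a ε ∪ OuterBilliards.R₂ a ε)).Nonempty := by
  refine ⟨1 / 2, by norm_num, fun N => ?_⟩
  -- The shift by 2 makes r at most `lam ^ 12`, which is below 7/100.
  obtain ⟨r, hQ⟩ : ∃ r : ℝ, (4096 / 15625 : ℝ) ^ (N + 2) = r := ⟨_, rfl⟩
  have hr : 0 < r := by rw [← hQ]; positivity
  have hr' : r ≤ 7 / 100 := by
    have h : (4096 / 15625 : ℝ) ^ N ≤ 1 := pow_le_one₀ (by norm_num) (by norm_num)
    rw [← hQ, pow_add]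
    linarith
  refine ⟨OuterBilliards.param r, ⟨?_, ?_⟩, 6 * (N + 2) + 4, by omega,
    OuterBilliards.orbit r (N + 2), OuterBilliards.orbit_isPeriodicOrbit hr hr' hQ,
    OuterBilliards.orbit_injOn hr hr' hQ, OuterBilliards.orbit_isAttracting hr hr' hQ, ?_⟩
  · linarith [OuterBilliards.le_param hr]
  · linarith [OuterBilliards.param_le hr']
  · exact fun ε _ hε => ⟨_, Set.mem_range_self 0,
      Or.inl (OuterBilliards.orbit_zero_mem_R₁ hr hr' hε)⟩
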